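/- **Conventions.** A multisorted relational signature $\Sigma$ consists of finitely many types and finitely many relational symbols $R$, each with an arity $\mathrm{ar}_R$, a finite (possibly empty) tuple of types. A $\Sigma$-structure $\mathbf A$ has a domain $A_t$ for each type $t$ (domains of distinct types are regarded as disjoint) and a relation $R^{\mathbf A}\subseteq A_{\mathrm{ar}_R(1)}\times\dots\times A_{\mathrm{ar}_R(k)}$ for each symbol $R$, where $k$ is the length of $\mathrm{ar}_R$. Homomorphisms are maps preserving types and all relations; $\mathbf X\to\mathbf A$ means that one exists. $\mathrm{CSP}(\mathbf A)$ is the problem to decide, for a given finite structure $\mathbf X$ of the same signature as $\mathbf A$, whether $\mathbf X\to\mathbf A$. For a finite Abelian group $\mathbb G$, $\mathrm{CSP}(\mathbb G)$ is the CSP whose template is the single-sorted structure with domain $G$, the ternary relation $\{(x_1,x_2,y) : x_1+x_2=y\}$, and for each $b\in G$ the unary relation $\{y : y=b\}$. (So $\mathrm{CSP}(\mathbb Z_p)$ is the problem of solving systems of linear equations modulo $p$.) **Datalog$^\cup$ reductions.** A *Datalog program* with input signature $\Pi$ consists of a signature $\Delta\supseteq\Pi$ with the same types, a finite set of rules $t_0\leftarrow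 t_1,\dots,t_r$ in typed variables, where $t_1,\dots,t_r$ are atomic $\Delta$-formulae (equalities allowed) and $t_0=R(x_1,\dots,x_m)$ with $R$ in $\Delta\setminus\Pi$, and a designated output symbol in $\Delta$. On a $\Pi$-structure $\mathbf A$ it outputs the relation that the output symbol receives in the least fixed point of the rules. The arity of the program is the arity of its output symbol. A *Datalog interpretation* $\phi$ from $\Pi$-structures to $\Sigma$-structures consists of Datalog programs $\phi_t$ for each $\Sigma$-type $t$ and $\phi_R$ for each $\Sigma$-symbol $R$, all with input signature $\Pi$, such that the arity of $\phi_R$ is the concatenation of the arities of $\phi_{\mathrm{ar}_R(1)},\dots,\phi_{\mathrm{ar}_R(k)}$. The structure $\phi(\mathbf A)$ has domains $\phi_t(\mathbf A)$, and its relation $R$ consists of those tuples of $\phi_{\mathrm{ar}_R(1)}(\mathbf A)\times\dots\times\phi_{\mathrm{ar}_R(k)}(\mathbf A)$ whose concatenation lies in $\phi_R(\mathbf A)$. A *union gadget* $\upsilon$ from $\Pi$ to $\Sigma$ is a pair of maps $(d,r)$, where $d$ maps $\Pi$-types to $\Sigma$-types and $r$ maps $\Pi$-symbols to $\Sigma$-symbols,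 such that $\mathrm{ar}_{r(R)}=d\circ\mathrm{ar}_R$ for all $R$. The structure $\upsilon(\mathbf A)$ has as its $t$-th domain the disjoint union of all $A_i$ with $d(i)=t$, and $S^{\upsilon(\mathbf A)}=\bigcup_{r(R)=S}R^{\mathbf A}$. Write $\mathrm{CSP}(\mathbf A)\leq_{\mathrm{DL}}\mathrm{CSP}(\mathbf B)$ if there are a Datalog interpretation $\phi$ (into structures of some signature) and a union gadget $\upsilon$ such that, for every finite structure $\mathbf X$ of the signature of $\mathbf A$, $\mathbf X\to\mathbf A$ implies $\upsilon(\phi(\mathbf X))\to\mathbf B$, and $\mathbf X\not\to\mathbf A$ implies $\upsilon(\phi(\mathbf X))\not\to\mathbf B$. **Proposition.** For all primes $p\neq q$, $\mathrm{CSP}(\mathbb Z_p)\not\leq_{\mathrm{DL}}\mathrm{CSP}(\mathbb Z_q)$. -/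

import Mathlib

namespace DatalogCSP

/-- A multisorted relational signature: a set of types, a set of relational symbols, and for each
symbol its arity, a tuple of types. -/
structure Signature where
  Ty : Type
  Sym : Type
  ar : Sym → List Ty

/-- A finite signature: finitely many types and finitely many symbols. -/
def Signature.IsFinite (S : Signature) : Prop := Finite S.Ty ∧ Finite S.Sym

/-- A multisorted relational structure of signature `S`. The (pairwise disjoint) domains `A_t` are
presented together: `El` is the set of all elements, `ty x` is the type of the element `x`, and the
domain of type `t` is `{x | ty x = t}`. The relation `rel R` is a set of tuples, and the tuples in
it have the types prescribed by the arity of `R`. -/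
structure RelStr (S : Signature) where
  El : Type
  ty : El → S.Ty
  rel : S.Sym → Set (List El)
  typed : ∀ R w, w ∈ rel R → w.map ty = S.ar R

/-- `f` is a homomorphism: it preserves types and all relations. -/
def IsHom {S : Signature} (A B : RelStr S) (f : A.El → B.El) : Prop :=
  (∀ x, B.ty (f x) = A.ty x) ∧ ∀ R, ∀ w ∈ A.rel R, w.map f ∈ B.rel R

/-- `A → B`: there is a homomorphism from `A` to `B`. -/
def Maps {S : Signature} (A B : RelStr S) : Prop := ∃ f : A.El → B.El, IsHom A B f

/-! ### Datalog -/

/-- The extension of the signature `S` by new symbols, with the same types. -/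
def Signature.extend (S : Signature) (IDB : Type) (arI : IDB → List S.Ty) : Signature where
  Ty := S.Ty
  Sym := S.Sym ⊕ IDB
  ar := Sum.elim S.ar arI

/-- Atomic formulae `R(x₁, …, xₙ)` and `x = y` with symbols in `Sym` and variables in `V`. -/
inductive Atom (Sym V : Type) where
  | rel (R : Sym) (args : List V) : Atom Sym V
  | eq (x y : V) : Atom Sym V

/-- The variables that occur in an atomic formula. -/
def Atom.vars {Sym V : Type} : Atom Sym V → List V
  | .rel _ args => args
  | .eq x y => [x, y]

/-- The atomic formula respects the types, where the variable `x` has type `vty x`. -/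
def Atom.WellTyped {D : Signature} {V : Type} (vty : V → D.Ty) : Atom D.Sym V → Prop
  | .rel R args => args.map vty = D.ar R
  | .eq x y => vty x = vty y

/-- A Datalog rule `t₀ ← t₁, …, tᵣ`, in the variables `Fin n`, each of which has a type and occurs
in the rule. The head `t₀` is `head(headArgs)` with `head` one of the new symbols; the body is a
list of atomic formulae over the extended signature. -/
structure Rule (S : Signature) (IDB : Type) (arI : IDB → List S.Ty) where
  n : ℕ
  vty : Fin n → S.Ty
  head : IDB
  headArgs : List (Fin n)
  head_typed : headArgs.map vty = arI head
  body : List (Atom (S.extend IDB arI).Sym (Fin n))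
  body_typed : ∀ a ∈ body, a.WellTyped (D := S.extend IDB arI) vty
  occurs : ∀ x : Fin n, x ∈ headArgs ∨ ∃ a ∈ body, x ∈ a.vars

/-- A Datalog program with input signature `S`: finitely many new symbols (IDBs), finitely many
rules, and one symbol (new, or of the input signature) designated as output. -/
structure Program (S : Signature) where
  IDB : Type
  finite_IDB : Finite IDB
  arI : IDB → List S.Ty
  rules : List (Rule S IDB arI)
  out : (S.extend IDB arI).Sym

/-- The arity of a Datalog program is the arity of its output symbol. -/
def Program.arity {S : Signature} (P : Program S) : List S.Ty :=
  (S.extend P.IDB P.arI).ar P.out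

/-- The fixed-point semantics: `P.Derives A R w` means that the tuple `w` is in the relation `R`
of the least fixed point of the program `P` on the input structure `A`. -/
inductive Program.Derives {S : Signature} (P : Program S) (A : RelStr S) :
    (S.extend P.IDB P.arI).Sym → List A.El → Prop
  | edb (R : S.Sym) (w : List A.El) (hw : w ∈ A.rel R) : Program.Derives P A (Sum.inl R) w
  | rule (r : Rule S P.IDB P.arI) (hr : r ∈ P.rules) (h : Fin r.n → A.El)
      (hty : ∀ x, A.ty (h x) = r.vty x)
      (hrel : ∀ R args, Atom.rel R args ∈ r.body → Program.Derives P A R (args.map h))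
      (heq : ∀ x y, Atom.eq x y ∈ r.body → h x = h y) :
      Program.Derives P A (Sum.inr r.head) (r.headArgs.map h)

/-- The output relation `P(A)`. -/
def Program.output {S : Signature} (P : Program S) (A : RelStr S) : Set (List A.El) :=
  {w | P.Derives A P.out w}

/-- A Datalog interpretation mapping `S`-structures to `T`-structures. The arity of the program
for a symbol `R` is the concatenation of the arities of the programs for the types in `ar R`. -/
structure Interpretation (S T : Signature) where
  tyProg : T.Ty → Program S
  symProg : T.Sym → Program S
  arity_eq : ∀ R, (symProg R).arity = (T.ar R).flatMap fun t => (tyProg t).arity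

/-- The `T`-structure `φ(A)`: the domain of type `t` is the output of the program for `t`, and a
tuple of such tuples is in `R` iff their concatenation is in the output of the program for `R`. -/
def Interpretation.apply {S T : Signature} (φ : Interpretation S T) (A : RelStr S) :
    RelStr T where
  El := (t : T.Ty) × {w : List A.El // w ∈ (φ.tyProg t).output A}
  ty := fun x => x.1
  rel := fun R => {v | v.map (fun x => x.1) = T.ar R ∧
    (v.flatMap fun x => x.2.1) ∈ (φ.symProg R).output A}
  typed := fun _ _ hv => hv.1

/-- A union gadget from `S` to `T`: a map of types and a map of symbols compatible with arities. -/
structure UnionGadget (S T : Signature) where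
  d : S.Ty → T.Ty
  r : S.Sym → T.Sym
  arity_eq : ∀ R, T.ar (r R) = (S.ar R).map d

/-- The `T`-structure `υ(A)`: the domain of type `t` is the disjoint union of the domains of the
types `i` with `d i = t`, and the relation `Q` is the union of the relations `R` with `r R = Q`. -/
def UnionGadget.apply {S T : Signature} (υ : UnionGadget S T) (A : RelStr S) : RelStr T where
  El := A.El
  ty := fun x => υ.d (A.ty x)
  rel := fun Q => {w | ∃ R, υ.r R = Q ∧ w ∈ A.rel R}
  typed := by
    rintro Q w ⟨R, rfl, hw⟩
    rw [υ.arity_eq, ← A.typed R w hw, List.map_map]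
    rfl

/-! ### Reductions between (promise) CSPs -/

/-- `ψ` is a reduction from `PCSP(A, A')` to `PCSP(B, B')`: on every finite instance `X` it is
complete and sound. -/
def IsReduction {S T : Signature} (ψ : RelStr S → RelStr T) (A A' : RelStr S) (B B' : RelStr T) :
    Prop :=
  ∀ X : RelStr S, Finite X.El →
    (Maps X A → Maps (ψ X) B) ∧ (¬ Maps X A' → ¬ Maps (ψ X) B')

/-- `PCSP(A, A') ≤_DL PCSP(B, B')`: some composition of a Datalog interpretation into a finite
signature `M` with a union gadget is a reduction. -/
def PCSPLeDL {S T : Signature} (A A' : RelStr S) (B B' : RelStr T) : Prop :=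
  ∃ (M : Signature) (_ : M.IsFinite) (φ : Interpretation S M) (υ : UnionGadget M T),
    IsReduction (fun X => υ.apply (φ.apply X)) A A' B B'

/-- `CSP(A) ≤_DL CSP(B)`, where `CSP(A)` is `PCSP(A, A)`. -/
def CSPLeDL {S T : Signature} (A : RelStr S) (B : RelStr T) : Prop :=
  PCSPLeDL A A B B

/-! ### The CSP of a group -/

/-- The relational symbols of the template of an Abelian group: `x₁ + x₂ = y`, and `y = b` for
each group element `b`. -/
inductive GroupSym (G : Type) where
  | add : GroupSym G
  | const (b : G) : GroupSym G

/-- The single-sorted signature of systems of linear equations over `G`. -/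
def groupSig (G : Type) : Signature where
  Ty := Unit
  Sym := GroupSym G
  ar := fun R => match R with
    | .add => [(), (), ()]
    | .const _ => [()]

/-- The relations of the template of `CSP(G)`. -/
def groupRel (G : Type) [AddCommGroup G] : GroupSym G → Set (List G)
  | .add => {w | ∃ x₁ x₂ y : G, w = [x₁, x₂, y] ∧ x₁ + x₂ = y}
  | .const b => {w | ∃ y : G, w = [y] ∧ y = b}

/-- The template of `CSP(G)`. -/
def groupTemplate (G : Type) [AddCommGroup G] : RelStr (groupSig G) where
  El := G
  ty := fun _ => ()
  rel := groupRel G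
  typed := by
    rintro (_ | b) w hw
    · obtain ⟨x₁, x₂, y, rfl, -⟩ := hw
      rfl
    · obtain ⟨y, rfl, -⟩ := hw
      rfl

end DatalogCSP

/-!
A symmetric polymorphism `m` of the target template lets one average over a family of maps `X → A`
as soon as, up to a permutation of the family, the members look the same from every small set of
elements. A Datalog rule only sees a bounded number of elements at a time, so it suffices that the
maps are homomorphisms away from an obstacle, provided the obstacle can be moved out of every small
set at the price of permuting the family. If such families exist for unsolvable instances of
`CSP(A)`, then no Datalog interpretation followed by a union gadget distinguishes these instances
from `A` itself.

For a group `G`, such an instance asks for a flow on a discrete torus that is conserved except for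
a single source: the total outflow differs from the total inflow, but the flow exists once a sink is
allowed somewhere. The sink is moved by adding a flow supported on one row and one column, and
moving it translates the circulations, which form the index set of the family. Their number divides
a power of `|G|`, so averages over them make sense in any group in which one can divide by `|G|`.
-/

namespace DatalogCSP

theorem Maps.refl {S : Signature} (A : RelStr S) : Maps A A :=
  ⟨id, fun _ => rfl, fun _ w hw => by rwa [List.map_id]⟩

section Width

variable {S : Signature}

/-- The bound on a Datalog program that controls how many elements a single derivation step and a
single output tuple can involve. -/
def Program.WidthLE (P : Program S) (k : ℕ) : Prop :=
  P.arity.length ≤ k ∧ ∀ r ∈ P.rules, r.n ≤ k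

/-- All programs of the interpretation have width at most `k`. -/
def Interpretation.WidthLE {T : Signature} (φ : Interpretation S T) (k : ℕ) : Prop :=
  (∀ t, (φ.tyProg t).WidthLE k) ∧ ∀ R, (φ.symProg R).WidthLE k

theorem Program.WidthLE.mono {P : Program S} {k l : ℕ} (h : P.WidthLE k) (hkl : k ≤ l) :
    P.WidthLE l :=
  ⟨h.1.trans hkl, fun r hr => (h.2 r hr).trans hkl⟩

theorem Program.exists_widthLE (P : Program S) : ∃ k, P.WidthLE k :=
  ⟨P.arity.length + (P.rules.map Rule.n).sum, Nat.le_add_right _ _, fun _ hr =>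
    (List.le_sum_of_mem (List.mem_map_of_mem hr)).trans (Nat.le_add_left _ _)⟩

theorem Interpretation.exists_widthLE {T : Signature} (hT : T.IsFinite) (φ : Interpretation S T) :
    ∃ k, φ.WidthLE k := by
  obtain ⟨_, _⟩ := hT
  choose b hb using fun i : T.Ty ⊕ T.Sym => (Sum.elim φ.tyProg φ.symProg i).exists_widthLE
  obtain ⟨k, hk⟩ := (Set.finite_range b).bddAbove
  have hle (i : T.Ty ⊕ T.Sym) : (Sum.elim φ.tyProg φ.symProg i).WidthLE k :=
    (hb i).mono (hk ⟨i, rfl⟩)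
  exact ⟨k, fun t => hle (.inl t), fun R => hle (.inr R)⟩

theorem Program.Derives.map_ty {P : Program S} {A : RelStr S}
    {R : (S.extend P.IDB P.arI).Sym} {w : List A.El} (hw : P.Derives A R w) :
    w.map A.ty = (S.extend P.IDB P.arI).ar R := by
  cases hw with
  | edb R _ hw => exact A.typed R w hw
  | rule r _ h hty _ _ =>
    have hcomp : A.ty ∘ h = r.vty := funext hty
    rw [List.map_map, hcomp, r.head_typed]
    rfl

theorem Program.WidthLE.length_le {P : Program S} {k : ℕ} (hP : P.WidthLE k) {A : RelStr S}
    {w : List A.El} (hw : w ∈ P.output A) : w.length ≤ k := by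
  have hlen : w.length = P.arity.length :=
    List.length_map A.ty ▸ congrArg List.length (Program.Derives.map_ty hw)
  exact hlen.le.trans hP.1

/-- The elements of `φ(A)`, of all types together. It unfolds to `(φ.apply A).El`. -/
abbrev Interpretation.Element {T : Signature} (φ : Interpretation S T) (A : RelStr S) : Type :=
  (t : T.Ty) × {w : List A.El // w ∈ (φ.tyProg t).output A}

end Width

/-- The operation `m` on `ι`-tuples is a symmetric polymorphism of `B`: it preserves types and
relations, and does not depend on the order of its arguments. -/
structure IsSymmetricPolymorphism {T : Signature} {ι : Type} (B : RelStr T)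
    (m : (ι → B.El) → B.El) : Prop where
  ty_eq : ∀ x t, (∀ i, B.ty (x i) = t) → B.ty (m x) = t
  map_mem_rel : ∀ Q (l : List (ι → B.El)), (∀ i, l.map (fun x => x i) ∈ B.rel Q) →
    l.map m ∈ B.rel Q
  comp_perm : ∀ x (e : Equiv.Perm ι), m (x ∘ e) = m x

/-- For each obstacle `v`, a family of maps `X → A` indexed by `ι` which preserve every relation on
the tuples that avoid the zone of `v`. Every tuple of length at most `k` avoids some obstacle, and
away from the zones of two obstacles the corresponding families differ only by a permutation. -/
structure LocalHoms {S : Signature} (X A : RelStr S) (V ι : Type) (k : ℕ) where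
  toFun : V → ι → X.El → A.El
  zone : V → Set X.El
  ty_toFun : ∀ v i x, A.ty (toFun v i x) = X.ty x
  map_mem_rel : ∀ v i R, ∀ w ∈ X.rel R, (∀ x ∈ w, x ∉ zone v) → w.map (toFun v i) ∈ A.rel R
  exists_avoids : ∀ w : List X.El, w.length ≤ k → ∃ v, ∀ x ∈ w, x ∉ zone v
  exists_perm : ∀ v v', ∃ e : Equiv.Perm ι, ∀ i x, x ∉ zone v → x ∉ zone v' →
    toFun v' (e i) x = toFun v i x

namespace LocalHoms

variable {S : Signature} {X A : RelStr S} {V ι : Type} {k : ℕ} (F : LocalHoms X A V ι k)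

/-- The tuple `w` has no entry in the zone of the obstacle `v`. -/
def Avoids (v : V) (w : List X.El) : Prop := ∀ x ∈ w, x ∉ F.zone v

theorem exists_perm_map_eq (v v' : V) : ∃ e : Equiv.Perm ι, ∀ i w, F.Avoids v w → F.Avoids v' w →
    w.map (F.toFun v' (e i)) = w.map (F.toFun v i) := by
  obtain ⟨e, he⟩ := F.exists_perm v v'
  exact ⟨e, fun i w hv hv' => List.map_congr_left fun x hx => he i x (hv x hx) (hv' x hx)⟩

theorem derives_map {P : Program S} (hP : P.WidthLE k) {R : (S.extend P.IDB P.arI).Sym}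
    {w : List X.El} (hw : P.Derives X R w) {v : V} (hv : F.Avoids v w) (i : ι) :
    P.Derives A R (w.map (F.toFun v i)) := by
  induction hw generalizing v i with
  | edb R w hw => exact .edb R _ (F.map_mem_rel v i R w hw hv)
  | rule r hr h hty _ heq ih =>
    -- The elements named by the rule may meet the zone of `v`, so the obstacle is moved first.
    obtain ⟨v', hv'⟩ := F.exists_avoids (List.ofFn h) (by simpa using hP.2 r hr)
    have avoids_args (args : List (Fin r.n)) : F.Avoids v' (args.map h) := by
      rintro _ hx
      obtain ⟨a, -, rfl⟩ := List.mem_map.1 hx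
      exact hv' _ (List.mem_ofFn.2 ⟨a, rfl⟩)
    obtain ⟨e, he⟩ := F.exists_perm_map_eq v v'
    rw [← he i _ hv (avoids_args _), List.map_map]
    refine .rule r hr _ (fun x => (F.ty_toFun _ _ _).trans (hty x)) (fun R args hR => ?_)
      fun x y hxy => congrArg (F.toFun v' (e i)) (heq x y hxy)
    rw [← List.map_map]
    exact ih R args hR (avoids_args args) (e i)

section Transport

variable {M : Signature} {φ : Interpretation S M} (hφ : φ.WidthLE k)

/-- The map induced by `F.toFun v i` on the elements of `φ(X)` that avoid `v`. -/
def transport (v : V) (i : ι) (x : {x : φ.Element X // F.Avoids v x.2.1}) : φ.Element A :=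
  ⟨x.1.1, x.1.2.1.map (F.toFun v i), F.derives_map (hφ.1 _) x.1.2.2 x.2 i⟩

theorem exists_perm_transport_eq (v v' : V) : ∃ e : Equiv.Perm ι, ∀ i (x : φ.Element X)
    (hv : F.Avoids v x.2.1) (hv' : F.Avoids v' x.2.1),
    F.transport hφ v' (e i) ⟨x, hv'⟩ = F.transport hφ v i ⟨x, hv⟩ := by
  obtain ⟨e, he⟩ := F.exists_perm_map_eq v v'
  exact ⟨e, fun i x hv hv' => Sigma.ext rfl (heq_of_eq (Subtype.ext (he i _ hv hv')))⟩

theorem map_transport_mem_rel (v : V) (i : ι) {R : M.Sym}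
    {l : List {x : φ.Element X // F.Avoids v x.2.1}}
    (hl : l.map Subtype.val ∈ (φ.apply X).rel R) :
    l.map (F.transport hφ v i) ∈ (φ.apply A).rel R := by
  obtain ⟨hty, hR⟩ := hl
  have havoids : F.Avoids v ((l.map Subtype.val).flatMap fun x => x.2.1) := fun y hy => by
    obtain ⟨_, hx, hyx⟩ := List.mem_flatMap.1 hy
    obtain ⟨x, -, rfl⟩ := List.mem_map.1 hx
    exact x.2 y hyx
  refine ⟨by rwa [List.map_map] at hty ⊢, ?_⟩
  have hmap := F.derives_map (hφ.2 R) hR havoids i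
  rw [List.map_flatMap, List.flatMap_map] at hmap
  exact Set.mem_of_eq_of_mem (List.flatMap_map ..) hmap

end Transport

end LocalHoms

theorem LocalHoms.maps_apply_of_isSymmetricPolymorphism {S M T : Signature} {X A : RelStr S}
    {B : RelStr T} {V ι : Type} {k : ℕ} (F : LocalHoms X A V ι k) {φ : Interpretation S M}
    (hφ : φ.WidthLE k) {υ : UnionGadget M T} {m : (ι → B.El) → B.El}
    (hm : IsSymmetricPolymorphism B m) (hA : Maps (υ.apply (φ.apply A)) B) :
    Maps (υ.apply (φ.apply X)) B := by
  obtain ⟨g, hgty, hg⟩ := hA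
  choose o ho using fun x : φ.Element X =>
    F.exists_avoids x.2.1 ((hφ.1 x.1).length_le x.2.2)
  let average (v : V) (x : {x : φ.Element X // F.Avoids v x.2.1}) : B.El :=
    m fun i => g (F.transport hφ v i x)
  have average_eq (v v' : V) (x : φ.Element X) (hv : F.Avoids v x.2.1)
      (hv' : F.Avoids v' x.2.1) : average v ⟨x, hv⟩ = average v' ⟨x, hv'⟩ := by
    obtain ⟨e, he⟩ := F.exists_perm_transport_eq hφ v v'
    refine .trans ?_ (hm.comp_perm _ e)
    exact congrArg m (funext fun i => congrArg g (he i x hv hv').symm)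
  let f (x : φ.Element X) : B.El := average (o x) ⟨x, ho x⟩
  refine ⟨f, fun x => hm.ty_eq _ _ fun i => hgty _, ?_⟩
  rintro Q (l : List (φ.Element X)) ⟨R, rfl, hl⟩
  obtain ⟨v, hv⟩ := F.exists_avoids _ ((hφ.2 R).length_le hl.2)
  lift l to List {x : φ.Element X // F.Avoids v x.2.1} using
    fun x hx y hy => hv y (List.mem_flatMap.2 ⟨x, hx, hy⟩)
  have hmem : l.map (average v) ∈ B.rel (υ.r R) := by
    have hrows (i : ι) : l.map (fun x => g (F.transport hφ v i x)) ∈ B.rel (υ.r R) :=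
      Set.mem_of_eq_of_mem List.map_map.symm
        (hg (υ.r R) _ ⟨R, rfl, F.map_transport_mem_rel hφ v i hl⟩)
    have haverage := hm.map_mem_rel (υ.r R) (l.map fun x i => g (F.transport hφ v i x)) fun i =>
      Set.mem_of_eq_of_mem List.map_map (hrows i)
    rwa [List.map_map] at haverage
  have hf : (l.map Subtype.val).map f = l.map (average v) := by
    rw [List.map_map]
    exact List.map_congr_left fun x _ => average_eq _ v x.1 (ho x) x.2
  exact Set.mem_of_eq_of_mem hf hmem

theorem not_cspLeDL_of_localHoms {S T : Signature} {A : RelStr S} {B : RelStr T}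
    (hA : Finite A.El)
    (h : ∀ k, ∃ (X : RelStr S) (V ι : Type) (_ : LocalHoms X A V ι k) (m : (ι → B.El) → B.El),
      Finite X.El ∧ ¬ Maps X A ∧ IsSymmetricPolymorphism B m) :
    ¬ CSPLeDL A B := by
  rintro ⟨M, hM, φ, υ, hred⟩
  obtain ⟨k, hk⟩ := φ.exists_widthLE hM
  obtain ⟨X, V, ι, F, m, hX, hXA, hm⟩ := h k
  exact (hred X hX).2 hXA
    (F.maps_apply_of_isSymmetricPolymorphism hk hm ((hred A hA).1 (Maps.refl A)))

section GroupTemplate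

variable {G : Type} [AddCommGroup G]

theorem mem_groupRel_add {a b c : G} : [a, b, c] ∈ groupRel G .add ↔ a + b = c := by
  constructor
  · rintro ⟨x, y, z, hl, h⟩
    simp only [List.cons.injEq, and_true] at hl
    obtain ⟨rfl, rfl, rfl⟩ := hl
    exact h
  · exact fun h => ⟨a, b, c, rfl, h⟩

theorem mem_groupRel_const {a b : G} : [a] ∈ groupRel G (.const b) ↔ a = b := by
  constructor
  · rintro ⟨y, hl, rfl⟩
    exact List.singleton_inj.1 hl
  · exact fun h => ⟨a, rfl, h⟩

theorem length_eq_of_mem_groupRel {R : GroupSym G} {w : List G} (hw : w ∈ groupRel G R) :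
    w.length = ((groupSig G).ar R).length :=
  (List.length_map _).symm.trans (congrArg List.length ((groupTemplate G).typed R w hw))

theorem isSymmetricPolymorphism_of_nsmul_eq_sum {ι : Type} [Fintype ι] [Nonempty ι]
    {m : (ι → G) → G} (hinj : Function.Injective fun x : G => Fintype.card ι • x)
    (hm : ∀ x, Fintype.card ι • m x = ∑ i, x i) : IsSymmetricPolymorphism (groupTemplate G) m where
  ty_eq _ _ _ := rfl
  map_mem_rel R l hl := by
    change List (ι → G) at l
    have hlen : l.length = ((groupSig G).ar R).length :=
      (List.length_map _).symm.trans (length_eq_of_mem_groupRel (hl (Classical.arbitrary ι)))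
    cases R with
    | add =>
      obtain ⟨x, y, z, rfl⟩ := List.length_eq_three.1 hlen
      have hadd : x + y = z := funext fun i => mem_groupRel_add.1 (hl i)
      have havg : m x + m y = m z := hinj <| by
        simp only [smul_add, hm, ← hadd, Pi.add_apply, Finset.sum_add_distrib]
      exact (mem_groupRel_add (G := G)).2 havg
    | const b =>
      obtain ⟨x, rfl⟩ := List.length_eq_one_iff.1 hlen
      have hconst (i : ι) : x i = b := mem_groupRel_const.1 (hl i)
      have havg : m x = b := hinj <| by simp only [hm, hconst, Finset.sum_const, Finset.card_univ]
      exact (mem_groupRel_const (G := G)).2 havg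
  comp_perm x e := hinj <| by
    change ι → G at x
    exact (hm _).trans ((Equiv.sum_comp e x).trans (hm x).symm)

theorem exists_isSymmetricPolymorphism_groupTemplate {ι : Type} [Finite ι] [Nonempty ι]
    (h : Function.Bijective fun x : G => Nat.card ι • x) :
    ∃ m : (ι → G) → G, IsSymmetricPolymorphism (groupTemplate G) m := by
  have := Fintype.ofFinite ι
  rw [Nat.card_eq_fintype_card] at h
  choose m hm using fun x : ι → G => h.2 (∑ i, x i)
  exact ⟨m, isSymmetricPolymorphism_of_nsmul_eq_sum h.1 hm⟩

theorem bijective_nsmul_of_dvd_pow {c d N : ℕ} (hcd : c ∣ d ^ N)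
    (hd : Function.Bijective fun x : G => d • x) : Function.Bijective fun x : G => c • x := by
  obtain ⟨b, hb⟩ := hcd
  have hpow : Function.Bijective fun x : G => d ^ N • x := smul_iterate (α := G) d N ▸ hd.iterate N
  have hcb : (fun x : G => d ^ N • x) = (c • ·) ∘ (b • ·) :=
    funext fun x => by rw [hb, mul_smul, Function.comp_apply]
  have hbc : (fun x : G => d ^ N • x) = (b • ·) ∘ (c • ·) :=
    funext fun x => by rw [hb, mul_comm, mul_smul, Function.comp_apply]
  exact ⟨.of_comp (hbc ▸ hpow.1), .of_comp (hcb ▸ hpow.2)⟩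

end GroupTemplate

section Torus

/-- The discrete torus, with a directed edge from each position `g` to `g + (1, 0)` and to
`g + (0, 1)`. -/
abbrev Torus (n : ℕ) := ZMod n × ZMod n

/-- Functions on the edges of the torus: `x.1 g` is the value on the horizontal edge that enters
the position `g`, and `x.2 g` the value on the vertical edge that enters `g`. -/
abbrev Flow (G : Type) (n : ℕ) := (Torus n → G) × (Torus n → G)

variable {G : Type} [AddCommGroup G] {n : ℕ}

/-- The net outflow of a flow at each position of the torus. -/
def divergence : Flow G n →+ (Torus n → G) where
  toFun x g := x.1 (g + (1, 0)) + x.2 (g + (0, 1)) - (x.1 g + x.2 g)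
  map_zero' := by ext; simp
  map_add' x y := by
    ext
    simp only [Prod.fst_add, Prod.snd_add, Pi.add_apply]
    abel

theorem divergence_apply (x : Flow G n) (g : Torus n) :
    divergence x g = x.1 (g + (1, 0)) + x.2 (g + (0, 1)) - (x.1 g + x.2 g) := rfl

theorem sum_divergence [NeZero n] (x : Flow G n) : ∑ g, divergence x g = 0 := by
  have hfst := Equiv.sum_comp (Equiv.addRight ((1, 0) : Torus n)) x.1
  have hsnd := Equiv.sum_comp (Equiv.addRight ((0, 1) : Torus n)) x.2
  simp only [Equiv.coe_addRight] at hfst hsnd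
  simp only [divergence_apply, Finset.sum_sub_distrib, Finset.sum_add_distrib, hfst, hsnd, sub_self]

variable (G n) in
/-- The flows that are conserved at every position. -/
abbrev circulations : AddSubgroup (Flow G n) := divergence.ker

theorem card_circulations_dvd [NeZero n] :
    Nat.card (circulations G n) ∣ Nat.card G ^ (2 * (n * n)) := by
  have hcard : Nat.card (Flow G n) = Nat.card G ^ (2 * (n * n)) := by
    simp only [Nat.card_prod, Nat.card_fun, Nat.card_zmod]
    ring
  exact hcard ▸ (circulations G n).card_addSubgroup_dvd_card

/-- The amount `a` can be sent from `v` to `v'` using only edges that enter a position in `s`. -/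
def Routable (a : G) (s : Set (Torus n)) (v v' : Torus n) : Prop :=
  ∃ x : Flow G n, divergence x = Pi.single v a - Pi.single v' a ∧
    ∀ g ∉ s, x.1 g = 0 ∧ x.2 g = 0

namespace Routable

variable {a : G} {s t : Set (Torus n)} {v v' v'' : Torus n}

theorem refl (v : Torus n) : Routable a s v v :=
  ⟨0, by rw [map_zero, sub_self], fun _ _ => ⟨rfl, rfl⟩⟩

theorem trans (h : Routable a s v v') (h' : Routable a s v' v'') : Routable a s v v'' := by
  obtain ⟨x, hx, hxs⟩ := h
  obtain ⟨y, hy, hys⟩ := h'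
  refine ⟨x + y, by rw [map_add, hx, hy, sub_add_sub_cancel], fun g hg => ?_⟩
  simp [hxs g hg, hys g hg]

theorem mono (h : Routable a s v v') (hst : s ⊆ t) : Routable a t v v' := by
  obtain ⟨x, hx, hxs⟩ := h
  exact ⟨x, hx, fun g hg => hxs g fun hgs => hg (hst hgs)⟩

theorem horizontal_edge (hv : v + (1, 0) ∈ s) : Routable a s v (v + (1, 0)) := by
  refine ⟨(Pi.single (v + (1, 0)) a, 0), ?_, fun g hg => ?_⟩
  · ext g
    simp [divergence_apply, Pi.single_apply]
  · simp [Pi.single_eq_of_ne (ne_of_mem_of_not_mem hv hg).symm]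

theorem vertical_edge (hv : v + (0, 1) ∈ s) : Routable a s v (v + (0, 1)) := by
  refine ⟨(0, Pi.single (v + (0, 1)) a), ?_, fun g hg => ?_⟩
  · ext g
    simp [divergence_apply, Pi.single_apply]
  · simp [Pi.single_eq_of_ne (ne_of_mem_of_not_mem hv hg).symm]

theorem row [NeZero n] (i i' j : ZMod n) : Routable a {g | g.2 = j} (i, j) (i', j) := by
  have hsteps (m : ℕ) : Routable a {g | g.2 = j} (i, j) (i + m, j) := by
    induction m with
    | zero => simpa using refl (i, j)
    | succ m ih =>
      refine ih.trans ?_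
      simpa [add_assoc] using
        horizontal_edge (a := a) (s := {g | g.2 = j}) (v := (i + m, j)) (by simp)
  simpa using hsteps (i' - i).val

theorem column [NeZero n] (i j j' : ZMod n) : Routable a {g | g.1 = i} (i, j) (i, j') := by
  have hsteps (m : ℕ) : Routable a {g | g.1 = i} (i, j) (i, j + m) := by
    induction m with
    | zero => simpa using refl (i, j)
    | succ m ih =>
      refine ih.trans ?_
      simpa [add_assoc] using
        vertical_edge (a := a) (s := {g | g.1 = i}) (v := (i, j + m)) (by simp)
  simpa using hsteps (j' - j).val

theorem row_column [NeZero n] (v v' : Torus n) :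
    Routable a {g | g.2 = v.2 ∨ g.1 = v'.1} v v' :=
  ((row v.1 v'.1 v.2).mono fun _ => .inl).trans ((column v'.1 v.2 v'.2).mono fun _ => .inr)

end Routable

/-- The five unknowns of `flowSystem` at each position: the values on the two edges that enter it,
their sum, the amount produced there, and the total amount that leaves it. -/
inductive Unknown where
  | horizontal | vertical | inflow | source | outflow

instance : Finite Unknown :=
  Finite.of_surjective ![.horizontal, .vertical, .inflow, .source, .outflow] <| by
    rintro (_ | _ | _ | _ | _)
    exacts [⟨0, rfl⟩, ⟨1, rfl⟩, ⟨2, rfl⟩, ⟨3, rfl⟩, ⟨4, rfl⟩]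

/-- The system of equations for a flow on the torus in which the amount `a` is produced at the
position `0` and nothing is consumed. -/
def flowSystem (a : G) (n : ℕ) : RelStr (groupSig G) where
  El := Unknown × Torus n
  ty := fun _ => ()
  rel := fun R => match R with
    | .add => {w | ∃ g : Torus n, w = [(.horizontal, g), (.vertical, g), (.inflow, g)] ∨
        w = [(.inflow, g), (.source, g), (.outflow, g)] ∨
        w = [(.horizontal, g + (1, 0)), (.vertical, g + (0, 1)), (.outflow, g)]}
    | .const b => {w | ∃ g : Torus n, w = [(.source, g)] ∧ (Pi.single 0 a : Torus n → G) g = b}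
  typed := by
    rintro (_ | b) w hw
    · obtain ⟨g, rfl | rfl | rfl⟩ := hw <;> rfl
    · obtain ⟨g, rfl, -⟩ := hw
      rfl

theorem not_maps_flowSystem [NeZero n] {a : G} (ha : a ≠ 0) :
    ¬ Maps (flowSystem a n) (groupTemplate G) := by
  rintro ⟨f, -, hf⟩
  let x (u : Unknown) (g : Torus n) : G := f (u, g)
  have inflow_eq (g) : x .horizontal g + x .vertical g = x .inflow g :=
    mem_groupRel_add.1 (hf .add _ ⟨g, .inl rfl⟩)
  have outflow_eq (g) : x .inflow g + x .source g = x .outflow g :=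
    mem_groupRel_add.1 (hf .add _ ⟨g, .inr (.inl rfl)⟩)
  have edges_eq (g) : x .horizontal (g + (1, 0)) + x .vertical (g + (0, 1)) = x .outflow g :=
    mem_groupRel_add.1 (hf .add _ ⟨g, .inr (.inr rfl)⟩)
  have source_eq (g) : x .source g = (Pi.single 0 a : Torus n → G) g :=
    mem_groupRel_const.1 (hf (.const _) _ ⟨g, rfl, rfl⟩)
  have hdiv : divergence (x .horizontal, x .vertical) = Pi.single 0 a := by
    ext g
    rw [divergence_apply, edges_eq, inflow_eq, ← outflow_eq, source_eq, add_sub_cancel_left]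
  have hsum := sum_divergence (x .horizontal, x .vertical)
  rw [hdiv, Fintype.sum_pi_single'] at hsum
  exact ha hsum

/-- The values of the unknowns of `flowSystem a n` that a flow determines. -/
def assignment (a : G) (x : Flow G n) : Unknown × Torus n → G
  | (.horizontal, g) => x.1 g
  | (.vertical, g) => x.2 g
  | (.inflow, g) => x.1 g + x.2 g
  | (.source, g) => (Pi.single 0 a : Torus n → G) g
  | (.outflow, g) => x.1 g + x.2 g + (Pi.single 0 a : Torus n → G) g

theorem assignment_add_of_eq_zero (a : G) (x : Flow G n) {y : Flow G n} {z : Unknown × Torus n}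
    (hy : y.1 z.2 = 0 ∧ y.2 z.2 = 0) : assignment a (x + y) z = assignment a x z := by
  obtain ⟨_ | _ | _ | _ | _, g⟩ := z <;> simp [assignment, show y.1 g = 0 from hy.1,
    show y.2 g = 0 from hy.2]

theorem map_assignment_mem_groupRel {a : G} {x : Flow G n} {v : Torus n}
    (hx : divergence x = Pi.single 0 a - Pi.single v a) {R : GroupSym G}
    {w : List (Unknown × Torus n)} (hw : w ∈ (flowSystem a n).rel R) (hv : ∀ z ∈ w, z.2 ≠ v) :
    w.map (assignment a x) ∈ groupRel G R := by
  cases R with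
  | add =>
    obtain ⟨g, rfl | rfl | rfl⟩ := hw
    · exact mem_groupRel_add.2 rfl
    · exact mem_groupRel_add.2 rfl
    · have hg : g ≠ v := hv (.outflow, g) (by simp)
      have hdiv := congrFun hx g
      rw [Pi.sub_apply, Pi.single_eq_of_ne hg, sub_zero, divergence_apply,
        sub_eq_iff_eq_add'] at hdiv
      exact mem_groupRel_add.2 hdiv
  | const b =>
    obtain ⟨g, rfl, hb⟩ := hw
    exact mem_groupRel_const.2 hb

theorem exists_row_column_avoids {α : Type} (w : List (α × Torus n)) (hw : w.length < n) :
    ∃ v : Torus n, ∀ z ∈ w, ¬ (z.2.2 = v.2 ∨ z.2.1 = v.1) := by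
  have : NeZero n := ⟨by lia⟩
  have exists_notMem_map (f : α × Torus n → ZMod n) : ∃ i, i ∉ w.map f :=
    Cardinal.exists_notMem_of_length_lt _ (by simpa using hw)
  obtain ⟨i, hi⟩ := exists_notMem_map fun z => z.2.1
  obtain ⟨j, hj⟩ := exists_notMem_map fun z => z.2.2
  refine ⟨(i, j), fun z hz => ?_⟩
  rintro (rfl | rfl)
  exacts [hj (List.mem_map_of_mem hz), hi (List.mem_map_of_mem hz)]

theorem nonempty_localHoms_flowSystem (a : G) {k : ℕ} (hk : k < n) :
    Nonempty (LocalHoms (flowSystem a n) (groupTemplate G) (Torus n) (circulations G n) k) := by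
  have : NeZero n := ⟨by lia⟩
  choose toSink divergence_toSink _ using fun v : Torus n =>
    Routable.row_column (a := a) (0 : Torus n) v
  refine ⟨{
    toFun v c := assignment (G := G) a (toSink v + c.1)
    zone v := {z | z.2.2 = v.2 ∨ z.2.1 = v.1}
    ty_toFun _ _ _ := rfl
    map_mem_rel v c R w hw hv := ?_
    exists_avoids w hw := exists_row_column_avoids w (hw.trans_lt hk)
    exists_perm v v' := ?_ }⟩
  · refine map_assignment_mem_groupRel ?_ hw fun z hz hzv => hv z hz (.inl (congrArg Prod.snd hzv))
    rw [map_add, divergence_toSink, AddMonoidHom.mem_ker.1 c.2, add_zero]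
  · obtain ⟨d, hd, hdsupp⟩ := Routable.row_column (a := a) v v'
    have hcirc : toSink v + d - toSink v' ∈ circulations G n := by
      rw [AddMonoidHom.mem_ker, map_sub, map_add, divergence_toSink, divergence_toSink, hd,
        sub_add_sub_cancel, sub_self]
    refine ⟨Equiv.addRight ⟨_, hcirc⟩, fun c z hz hz' => ?_⟩
    have htranslate : toSink v' + (c + (toSink v + d - toSink v')) = toSink v + c + d := by abel
    have hzero := hdsupp z.2 (not_or.2 ⟨fun h => hz (.inl h), fun h => hz' (.inr h)⟩)
    exact (congrArg (fun x => assignment a x z) htranslate).trans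
      (assignment_add_of_eq_zero a _ hzero)

end Torus

theorem not_cspLeDL_groupTemplate {G : Type} [AddCommGroup G] [Finite G] [Nontrivial G]
    {T : Signature} {B : RelStr T}
    (hB : ∀ (ι : Type) [Finite ι] [Nonempty ι], (∃ N, Nat.card ι ∣ Nat.card G ^ N) →
      ∃ m : (ι → B.El) → B.El, IsSymmetricPolymorphism B m) :
    ¬ CSPLeDL (groupTemplate G) B := by
  refine not_cspLeDL_of_localHoms (inferInstanceAs (Finite G)) fun k => ?_
  obtain ⟨a, ha⟩ := exists_ne (0 : G)
  obtain ⟨F⟩ := nonempty_localHoms_flowSystem a k.lt_succ_self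
  obtain ⟨m, hm⟩ := hB (circulations G (k + 1)) ⟨_, card_circulations_dvd⟩
  exact ⟨_, _, _, F, m, inferInstanceAs (Finite (Unknown × Torus (k + 1))),
    not_maps_flowSystem ha, hm⟩

end DatalogCSP

open DatalogCSP in
theorem mainTheorem8_general {G H : Type} [AddCommGroup G] [Finite G] [Nontrivial G]
    [AddCommGroup H] (h : Function.Bijective fun x : H => Nat.card G • x) :
    ¬ CSPLeDL (groupTemplate G) (groupTemplate H) :=
  not_cspLeDL_groupTemplate fun _ _ _ ⟨_, hN⟩ =>
    exists_isSymmetricPolymorphism_groupTemplate (G := H) (bijective_nsmul_of_dvd_pow hN h)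

theorem mainTheorem8 (p q : ℕ) (hp : p.Prime) (hq : q.Prime) (hpq : p ≠ q) :
    ¬ DatalogCSP.CSPLeDL (DatalogCSP.groupTemplate (ZMod p)) (DatalogCSP.groupTemplate (ZMod q)) := by
  have : Fact p.Prime := ⟨hp⟩
  have : Fact q.Prime := ⟨hq⟩
  refine mainTheorem8_general (nsmulCoprime ?_).bijective
  simpa only [Nat.card_zmod] using (Nat.coprime_primes hq hp).2 hpq.symm
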